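/- Let $M$ be a smooth $2n$-dimensional manifold with two Poisson tensors $P_0,P_1:T^*M\to TM$ (brackets $\{f,g\}_a=\langle df,P_a\,dg\rangle$) such that $P_1-tP_0$ is Poisson for every $t\in\mathbb R$ and $P_0$ is invertible. Put $\omega_0(v,w)=\langle P_0^{-1}v,w\rangle$ and $N=P_1P_0^{-1}$. Let $(\lambda_1,\dots,\lambda_n;\mu_1,\dots,\mu_n)$ be Darboux–Nijenhuis coordinates on an open set $D\subseteq M$, i.e. a smooth chart with $$\omega_0=\sum_{i=1}^n d\mu_i\wedge d\lambda_i,\qquad N^*d\lambda_i=\lambda_i\,d\lambda_i,\qquad N^*d\mu_i=\lambda_i\,d\mu_i .$$ Let $C_1,\dots,C_n$ be smooth functions on $D$ with Hamiltonian vector fields $X_{2i-1}=P_0\,dC_i$, let $\mathsf F=(\mathsf F_i^j)$ be a smooth $n\times n$ matrix of functions on $D$ (row index $i$, column index $j$) with $$N X_{2i-1}=\sum_{j=1}^n \mathsf F_i^j X_{2j-1}\quad(i=1,\dots,n),\qquad N^*d\mathsf F=\mathsf F\,d\mathsf F$$ ($N^*$ acts entrywise on the matrix of one-forms $d\mathsf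 F$, and $\mathsf F\,d\mathsf F$ is the matrix product), and let $\mathsf T$ be a smooth, everywhere invertible matrix of functions on $D$, whose rows are left eigenvectors of $\mathsf F$, with $$\mathsf F=\mathsf T^{-1}\,\mathrm{diag}(\lambda_1,\dots,\lambda_n)\,\mathsf T ,$$ normalized so that in each row some entry is a nonzero constant (for instance, the last column is identically $1$). Say that a function $g$ on $D$ depends only on $(\lambda_i,\mu_i)$ if $g=u(\lambda_i,\mu_i)$, with $u$ a smooth function of two variables, in a neighbourhood of every point of $D$, and also on every open $V\subseteq D$ such that the level sets of $(\lambda_i,\mu_i)$ in $V$ are connected. Then: 1. for every $i$, the $i$-th component of $\mathbf U=\mathsf T\mathbf C$, $\mathbf C=(C_1,\dots,C_n)^{T}$, depends only on $(\lambda_i,\mu_i)$; 2. the entries of the $i$-th row of $\mathsf T$ depend only on $(\lambda_i,\mu_i)$, so that the equations $\sum_j \mathsf T_{ij}C_j=\mathbf U_i$ are separation relations for $C_1,\dots,C_n$; 3. consequently the Hamilton–Jacobi equations of the flows $X_1,X_3,\dots,X_{2n-1}$ separate in these coordinates: near every point $x_0\in D$ at which $\det(\partial C_j/\partial\mu_i)\neq0$,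 the equations $$C_j\Big(\lambda_1,\dots,\lambda_n,\frac{\partial S}{\partial\lambda_1},\dots,\frac{\partial S}{\partial\lambda_n}\Big)=a_j,\qquad j=1,\dots,n,$$ have a common smooth additively separated complete integral $S(\lambda;a)=\sum_{i=1}^n W_i(\lambda_i;a_1,\dots,a_n)$, defined for $\lambda$ near $\lambda(x_0)$ and $a$ near $\mathbf C(x_0)$, with $\det\big(\partial^2S/\partial\lambda_i\partial a_j\big)\neq0$ and $\partial S/\partial\lambda_i=\mu_i(x_0)$ for all $i$ at $\lambda=\lambda(x_0)$, $a=\mathbf C(x_0)$. -/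

import Mathlib

open scoped Manifold ContDiff

noncomputable section

/-- The model space `ℝ²ⁿ` of a `2n`-dimensional manifold. -/
abbrev Model (n : ℕ) : Type := EuclideanSpace ℝ (Fin (2 * n))

/-- The space `ℝⁿ × ℝⁿ` of coordinate values `(λ₁, …, λₙ; μ₁, …, μₙ)`. -/
abbrev Phase (n : ℕ) : Type := (Fin n → ℝ) × (Fin n → ℝ)

section Geometry

variable {n : ℕ} {M : Type*} [TopologicalSpace M] [ChartedSpace (Model n) M]

/-- The tangent space `T_x M`. -/
abbrev Tan (n : ℕ) {M : Type*} [TopologicalSpace M] [ChartedSpace (Model n) M] (x : M) : Type :=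
  TangentSpace 𝓘(ℝ, Model n) x

/-- The cotangent space `T*_x M`. -/
abbrev Cotan (n : ℕ) {M : Type*} [TopologicalSpace M] [ChartedSpace (Model n) M] (x : M) : Type :=
  Module.Dual ℝ (Tan n x)

/-- The differential `df` at `x`, as a covector. -/
def diffl (n : ℕ) {M : Type*} [TopologicalSpace M] [ChartedSpace (Model n) M]
    (f : M → ℝ) (x : M) : Cotan n x :=
  (mvfderiv 𝓘(ℝ, Model n) f x).toLinearMap

/-- The bracket `{f, g} = ⟨df, P dg⟩` of a field `P` of linear maps `T*M → TM`. -/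
def pbracket (P : ∀ x : M, Cotan n x →ₗ[ℝ] Tan n x) (f g : M → ℝ) (x : M) : ℝ :=
  diffl n f x (P x (diffl n g x))

/-- `P` is a Poisson tensor: a smooth bivector field whose bracket obeys the Jacobi identity. -/
structure IsPoissonTensor (P : ∀ x : M, Cotan n x →ₗ[ℝ] Tan n x) : Prop where
  skew : ∀ (x : M) (α β : Cotan n x), α (P x β) = -β (P x α)
  smooth : ∀ f g : M → ℝ, ContMDiff 𝓘(ℝ, Model n) 𝓘(ℝ, ℝ) ∞ f →
    ContMDiff 𝓘(ℝ, Model n) 𝓘(ℝ, ℝ) ∞ g →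
    ContMDiff 𝓘(ℝ, Model n) 𝓘(ℝ, ℝ) ∞ (pbracket P f g)
  jacobi : ∀ f g h : M → ℝ, ContMDiff 𝓘(ℝ, Model n) 𝓘(ℝ, ℝ) ∞ f →
    ContMDiff 𝓘(ℝ, Model n) 𝓘(ℝ, ℝ) ∞ g → ContMDiff 𝓘(ℝ, Model n) 𝓘(ℝ, ℝ) ∞ h →
    ∀ x, pbracket P f (pbracket P g h) x + pbracket P g (pbracket P h f) x
      + pbracket P h (pbracket P f g) x = 0

/-- A symplectic bi-Hamiltonian structure: two Poisson tensors such that every member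
`P₁ - t P₀` of the pencil is Poisson, `P₀` being invertible at every point. -/
structure SympBiham (n : ℕ) (M : Type*) [TopologicalSpace M] [ChartedSpace (Model n) M] where
  P₀ : ∀ x : M, Cotan n x →ₗ[ℝ] Tan n x
  P₁ : ∀ x : M, Cotan n x →ₗ[ℝ] Tan n x
  poisson₀ : IsPoissonTensor P₀
  pencil : ∀ t : ℝ, IsPoissonTensor (fun x => P₁ x - t • P₀ x)
  nondeg : ∀ x, Function.Bijective (P₀ x)

namespace SympBiham

variable (B : SympBiham n M)

/-- The inverse `P₀⁻¹ : TM → T*M`. -/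
def flat (x : M) : Tan n x →ₗ[ℝ] Cotan n x :=
  (LinearEquiv.ofBijective (B.P₀ x) (B.nondeg x)).symm.toLinearMap

/-- The symplectic form `ω₀(v, w) = ⟨P₀⁻¹ v, w⟩`, for which
`ω₀(X_f, X_g) = {f, g}₀` with `X_f = P₀ df`. -/
def omega (x : M) (v w : Tan n x) : ℝ := B.flat x v w

/-- The Nijenhuis tensor `N = P₁ P₀⁻¹`, for which `{f, g}₁ = ω₀(N X_f, X_g)`. -/
def N (x : M) : Tan n x →ₗ[ℝ] Tan n x := B.P₁ x ∘ₗ B.flat x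

/-- The adjoint `N*` acting on covectors. -/
def Nstar (x : M) : Cotan n x →ₗ[ℝ] Cotan n x := (B.N x).dualMap

/-- The Hamiltonian vector field `P₀ df`. -/
def hamVF (f : M → ℝ) (x : M) : Tan n x := B.P₀ x (diffl n f x)

end SympBiham

/-- The coordinate function `λᵢ` of a chart with values in `ℝⁿ × ℝⁿ`. -/
def lam (φ : OpenPartialHomeomorph M (Phase n)) (i : Fin n) (x : M) : ℝ := (φ x).1 i

/-- The coordinate function `μᵢ` of a chart with values in `ℝⁿ × ℝⁿ`. -/
def mu (φ : OpenPartialHomeomorph M (Phase n)) (i : Fin n) (x : M) : ℝ := (φ x).2 i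

/-- `φ = (λ, μ)` is a system of Darboux–Nijenhuis coordinates on the open set `φ.source`. -/
structure IsDarbouxNijenhuis (B : SympBiham n M)
    (φ : OpenPartialHomeomorph M (Phase n)) : Prop where
  smooth : ContMDiffOn 𝓘(ℝ, Model n) 𝓘(ℝ, Phase n) ∞ φ φ.source
  smooth_symm : ContMDiffOn 𝓘(ℝ, Phase n) 𝓘(ℝ, Model n) ∞ φ.symm φ.target
  canonical : ∀ x ∈ φ.source, ∀ v w : Tan n x, B.omega x v w =
    ∑ i, (diffl n (mu φ i) x v * diffl n (lam φ i) x w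
      - diffl n (mu φ i) x w * diffl n (lam φ i) x v)
  Nstar_lam : ∀ x ∈ φ.source, ∀ i,
    B.Nstar x (diffl n (lam φ i) x) = lam φ i x • diffl n (lam φ i) x
  Nstar_mu : ∀ x ∈ φ.source, ∀ i,
    B.Nstar x (diffl n (mu φ i) x) = lam φ i x • diffl n (mu φ i) x

/-- `g = u(λᵢ, μᵢ)` on `V` for a smooth function `u` of two variables. -/
def FactorsThroughPair (φ : OpenPartialHomeomorph M (Phase n)) (i : Fin n) (g : M → ℝ)
    (V : Set M) : Prop :=
  ∃ u : ℝ × ℝ → ℝ, ContDiffOn ℝ ∞ u ((fun x => (lam φ i x, mu φ i x)) '' V) ∧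
    ∀ x ∈ V, g x = u (lam φ i x, mu φ i x)

/-- `g` depends only on the pair `(λᵢ, μᵢ)`: it is a smooth function of this pair near every
point of the coordinate domain, and also on every open part of the coordinate domain
on which the level sets of `(λᵢ, μᵢ)` are connected. -/
def DependsOnlyOnPair (φ : OpenPartialHomeomorph M (Phase n)) (i : Fin n) (g : M → ℝ) : Prop :=
  (∀ x ∈ φ.source, ∃ V : Set M, IsOpen V ∧ x ∈ V ∧ V ⊆ φ.source ∧ FactorsThroughPair φ i g V) ∧
  (∀ V : Set M, IsOpen V → V ⊆ φ.source →
    (∀ a b : ℝ, IsPreconnected {x ∈ V | lam φ i x = a ∧ mu φ i x = b}) →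
    FactorsThroughPair φ i g V)

end Geometry

section HamiltonJacobi

variable {n : ℕ}

/-- The gradient `(∂S/∂q₁, …, ∂S/∂qₙ)` of `S(q; a)` in the variable `q`. -/
def gradQ (S : (Fin n → ℝ) × (Fin n → ℝ) → ℝ) (q a : Fin n → ℝ) : Fin n → ℝ :=
  fun i => fderiv ℝ (fun q' => S (q', a)) q (Pi.single i 1)

/-- `S(q; a)` is, for `q ∈ Q` and `a ∈ A`, a complete integral of the Hamilton–Jacobi equations
`H_j(q, ∂S/∂q) = a_j`, `j = 1, …, n`, of Hamiltonians `H_j` defined on `D ⊆ ℝⁿ × ℝⁿ`. -/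
structure IsCompleteIntegral (H : Fin n → Phase n → ℝ) (D : Set (Phase n))
    (Q A : Set (Fin n → ℝ)) (S : (Fin n → ℝ) × (Fin n → ℝ) → ℝ) : Prop where
  smooth : ContDiffOn ℝ ∞ S (Q ×ˢ A)
  mem : ∀ q ∈ Q, ∀ a ∈ A, (q, gradQ S q a) ∈ D
  solves : ∀ q ∈ Q, ∀ a ∈ A, ∀ j, H j (q, gradQ S q a) = a j
  nondeg : ∀ q ∈ Q, ∀ a ∈ A, (Matrix.of fun i j : Fin n =>
    fderiv ℝ (fun a' => gradQ S q a' i) a (Pi.single j 1)).det ≠ 0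

/-- The Hamilton–Jacobi equations of the Hamiltonians `H_j` separate near `z = (q₀, p₀)`: they have
a common complete integral of the form `∑ᵢ Wᵢ(qᵢ; a)`, for `q` near `q₀` and `a` near `H(z)`,
whose gradient at `q₀`, for `a = H(z)`, is `p₀`. -/
def HJSeparatesAt (H : Fin n → Phase n → ℝ) (D : Set (Phase n)) (z : Phase n) : Prop :=
  ∃ (W : Fin n → ℝ × (Fin n → ℝ) → ℝ) (Q A : Set (Fin n → ℝ)),
    IsOpen Q ∧ z.1 ∈ Q ∧ IsOpen A ∧ (fun j => H j z) ∈ A ∧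
    (∀ i, ContDiffOn ℝ ∞ (W i) (((fun q : Fin n → ℝ => q i) '' Q) ×ˢ A)) ∧
    IsCompleteIntegral H D Q A (fun y => ∑ i, W i (y.1 i, y.2)) ∧
    gradQ (fun y => ∑ i, W i (y.1 i, y.2)) z.1 (fun j => H j z) = z.2

/-- The matrix `∂H_j/∂p_i` at `z = (q, p)`. -/
def momentumJacobian (H : Fin n → Phase n → ℝ) (z : Phase n) : Matrix (Fin n) (Fin n) ℝ :=
  Matrix.of fun j i => fderiv ℝ (H j) z (0, Pi.single i 1)

end HamiltonJacobi

end

/-!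
Everything happens in the coordinates `z = (λ, μ)`, where `N*` multiplies both `dλₘ` and `dμₘ` by
`λₘ` (`IsDarbouxNijenhuis.N_coordVec_pairIncl`). Let `∂` be a derivative in the plane of the pair
`(λₘ, μₘ)`, and let `Λ = diag(λ₁, …, λₙ)`.

* `N* dF = F dF` becomes `λₘ ∂F = F ∂F`. Multiplying by `T` and using `T F = Λ T` gives
  `(λₘ - λₗ) (T ∂F)ₗ = 0`, hence `(T ∂F)ₗ = 0` for `l ≠ m`: the points with `λₘ ≠ λₗ` are dense.
  Differentiating `T F = Λ T` then shows that the row `∂Tₗ` is a left eigenvector of `F` for `λₗ`,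
  so it is a multiple of `Tₗ`, and this multiple is zero because one entry of `Tₗ` is a nonzero
  constant (`fderiv_row_eq_zero`).
* Since `P₀` and `P₁ = N P₀` are skew-symmetric, `N X_C = F X_C` says that `N* dC = F dC`
  (`SympBiham.diffl_N_eq`), that is `λₘ ∂C = F ∂C`, and in the same way `(T ∂C)ₗ = 0` for `l ≠ m`
  (`sum_row_mul_fderiv_eq_zero`).

Hence the rows `Tₗ` and the components `(T C)ₗ` have zero derivative along all pairs but the `l`-th.
Such functions are functions of `(λₗ, μₗ)` on coordinate boxes, and these local expressions glue
when the level sets of the pair are connected (`dependsOnlyOnPair_of_fderiv_eq_zero`).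

For the Hamilton–Jacobi equations, the inverse function theorem solves `C(q, p) = a` by
`p = w(q, a)`. As `T ∂C/∂p` is diagonal and invertible while `T ∂C/∂q` is diagonal, differentiating
`C(q, w(q, a)) = a` in `q` shows that `wₗ` depends on `qₗ` and `a` only. The primitives
`Wₗ(qₗ; a) = ∫ wₗ dqₗ` add up to the complete integral
(`hjSeparatesAt_of_sum_mul_fderiv_eq_zero`).
-/

noncomputable section

/-! ### Derivatives along the planes of the pairs `(λₘ, μₘ)` -/

/-- The inclusion of the plane of the pair `(λₘ, μₘ)` into `ℝⁿ × ℝⁿ`. -/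
def pairIncl {n : ℕ} (m : Fin n) : ℝ × ℝ →L[ℝ] Phase n :=
  (ContinuousLinearMap.single ℝ (fun _ : Fin n => ℝ) m).prodMap
    (ContinuousLinearMap.single ℝ (fun _ : Fin n => ℝ) m)

@[simp] theorem pairIncl_fst {n : ℕ} (m : Fin n) (w : ℝ × ℝ) :
    (pairIncl m w).1 = Pi.single m w.1 := rfl

@[simp] theorem pairIncl_snd {n : ℕ} (m : Fin n) (w : ℝ × ℝ) :
    (pairIncl m w).2 = Pi.single m w.2 := rfl

/-- A factor `λᵢ - λₗ` can be cancelled from an identity between continuous functions, since the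
points with `λᵢ ≠ λₗ` are dense. -/
theorem eq_zero_of_sub_mul_eq_zero {n : ℕ} {U : Set (Phase n)} (hU : IsOpen U)
    {h : Phase n → ℝ} (hh : ContinuousOn h U) {i l : Fin n} (hil : i ≠ l)
    (H : ∀ z ∈ U, (z.1 i - z.1 l) * h z = 0) : ∀ z ∈ U, h z = 0 := by
  intro z hz
  by_contra hne
  have hopen : IsOpen (U ∩ h ⁻¹' {0}ᶜ) := hh.isOpen_inter_preimage hU isOpen_compl_singleton
  let γ : ℝ → Phase n := fun t => z + t • pairIncl i (1, 0)
  have hγ : Continuous γ := by fun_prop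
  have h0 : γ 0 = z := by simp [γ]
  have hmem : γ ⁻¹' (U ∩ h ⁻¹' {0}ᶜ) ∈ nhds (0 : ℝ) :=
    (hopen.preimage hγ).mem_nhds (by rw [Set.mem_preimage, h0]; exact ⟨hz, hne⟩)
  -- On `γ` the difference `λᵢ - λₗ` is affine with slope one, so it vanishes at one point only.
  obtain ⟨t, ⟨htU, htne⟩, htd⟩ : ∃ t, t ∈ γ ⁻¹' (U ∩ h ⁻¹' {0}ᶜ) ∧ t ≠ z.1 l - z.1 i := by
    obtain ⟨ε, hε, hb⟩ := Metric.mem_nhds_iff.1 hmem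
    by_cases hd : ε / 2 = z.1 l - z.1 i
    · exact ⟨0, hb (Metric.mem_ball_self hε), by rw [← hd]; positivity⟩
    · exact ⟨ε / 2, hb (by simp [abs_of_pos hε, hε]), hd⟩
  have := H _ htU
  rcases mul_eq_zero.1 this with h1 | h1
  · apply htd
    simp [γ, Pi.single_eq_of_ne hil.symm] at h1
    linarith
  · exact htne h1

/-! ### Differential consequences of the Nijenhuis relations -/

section Flat

variable {n : ℕ} {U : Set (Phase n)}

theorem differentiableAt_of_contDiffOn {E G : Type*} [NormedAddCommGroup E] [NormedSpace ℝ E]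
    [NormedAddCommGroup G] [NormedSpace ℝ G] {U : Set E} (hU : IsOpen U) {f : E → G}
    (hf : ContDiffOn ℝ ∞ f U) {z : E} (hz : z ∈ U) : DifferentiableAt ℝ f z :=
  (hf.contDiffAt (hU.mem_nhds hz)).differentiableAt (by simp)

theorem continuousOn_fderiv_apply (hU : IsOpen U) {f : Phase n → ℝ}
    (hf : ContDiffOn ℝ ∞ f U) (v : Phase n) : ContinuousOn (fun z => fderiv ℝ f z v) U :=
  (hf.continuousOn_fderiv_of_isOpen hU (by simp)).clm_apply continuousOn_const

theorem fderiv_sum_mul_apply {ι E : Type*} [Fintype ι] [NormedAddCommGroup E] [NormedSpace ℝ E]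
    {f g : ι → E → ℝ} {z : E} (hf : ∀ p, DifferentiableAt ℝ (f p) z)
    (hg : ∀ p, DifferentiableAt ℝ (g p) z) (v : E) :
    fderiv ℝ (fun y => ∑ p, f p y * g p y) z v =
      ∑ p, (f p z * fderiv ℝ (g p) z v + g p z * fderiv ℝ (f p) z v) := by
  rw [fderiv_fun_sum (fun p _ => (hf p).fun_mul (hg p)), _root_.sum_apply]
  refine Finset.sum_congr rfl fun p _ => ?_
  rw [fderiv_fun_mul (hf p) (hg p)]
  rfl

theorem fderiv_fst_coord_pairIncl {l m : Fin n} (hml : m ≠ l) (z : Phase n) (w : ℝ × ℝ) :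
    fderiv ℝ (fun y : Phase n => y.1 l) z (pairIncl m w) = 0 := by
  have h : HasFDerivAt (fun y : Phase n => y.1 l)
      ((ContinuousLinearMap.proj l).comp (ContinuousLinearMap.fst ℝ (Fin n → ℝ) (Fin n → ℝ))) z :=
    ((ContinuousLinearMap.proj l).comp
      (ContinuousLinearMap.fst ℝ (Fin n → ℝ) (Fin n → ℝ))).hasFDerivAt
  rw [h.fderiv]
  simp [Pi.single_eq_of_ne hml.symm]

/-- The rows of a normalized diagonalizing matrix `T` of `F` separate: the row belonging to `λₗ`
has zero derivative along the pairs with index `m ≠ l`. -/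
theorem fderiv_row_eq_zero (hU : IsOpen U) {F T : Phase n → Matrix (Fin n) (Fin n) ℝ}
    (hF : ∀ i j, ContDiffOn ℝ ∞ (fun z => F z i j) U)
    (hT : ∀ i j, ContDiffOn ℝ ∞ (fun z => T z i j) U)
    (hdet : ∀ z ∈ U, (T z).det ≠ 0)
    (hTF : ∀ z ∈ U, T z * F z = Matrix.diagonal z.1 * T z)
    (hNF : ∀ z ∈ U, ∀ i j m w, z.1 m * fderiv ℝ (fun y => F y i j) z (pairIncl m w) =
      ∑ k, F z i k * fderiv ℝ (fun y => F y k j) z (pairIncl m w))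
    {k : Fin n → Fin n} {c : Fin n → ℝ} (hc : ∀ i, c i ≠ 0)
    (hnorm : ∀ z ∈ U, ∀ i, T z i (k i) = c i)
    {l m : Fin n} (hml : m ≠ l) (j : Fin n) (w : ℝ × ℝ) {z : Phase n} (hz : z ∈ U) :
    fderiv ℝ (fun y => T y l j) z (pairIncl m w) = 0 := by
  let dF : Phase n → Matrix (Fin n) (Fin n) ℝ :=
    fun z => Matrix.of fun i j => fderiv ℝ (fun y => F y i j) z (pairIncl m w)
  let dT : Phase n → Matrix (Fin n) (Fin n) ℝ :=
    fun z => Matrix.of fun i j => fderiv ℝ (fun y => T y i j) z (pairIncl m w)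
  have hTc : ContinuousOn T U :=
    continuousOn_pi.2 fun i => continuousOn_pi.2 fun j => (hT i j).continuousOn
  have hdFc : ContinuousOn dF U :=
    continuousOn_pi.2 fun i => continuousOn_pi.2 fun j => continuousOn_fderiv_apply hU (hF i j) _
  have hdTc : ContinuousOn dT U :=
    continuousOn_pi.2 fun i => continuousOn_pi.2 fun j => continuousOn_fderiv_apply hU (hT i j) _
  have hentry : ∀ {A : Phase n → Matrix (Fin n) (Fin n) ℝ}, ContinuousOn A U → ∀ i j,
      ContinuousOn (fun z => A z i j) U := fun hA i j =>
    continuousOn_pi.1 (continuousOn_pi.1 hA i) j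
  have hmul : ∀ {A B : Phase n → Matrix (Fin n) (Fin n) ℝ}, ContinuousOn A U → ContinuousOn B U →
      ContinuousOn (fun z => A z * B z) U := by
    intro A B hA hB
    exact (continuous_fst.matrix_mul continuous_snd).comp_continuousOn (hA.prodMk hB)
  have hNF' : ∀ z ∈ U, z.1 m • dF z = F z * dF z := by
    intro z hz
    ext i j
    simpa [Matrix.mul_apply, dF] using hNF z hz i j m w
  -- Rows `l ≠ m` of `T dF` vanish.
  have h1 : ∀ z ∈ U, ∀ j, (T z * dF z) l j = 0 := by
    intro z hz j
    refine eq_zero_of_sub_mul_eq_zero hU (hentry (hmul hTc hdFc) l j) hml ?_ z hz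
    intro z hz
    have e : z.1 m • (T z * dF z) = Matrix.diagonal z.1 * (T z * dF z) := by
      rw [← Matrix.mul_smul, hNF' z hz, ← Matrix.mul_assoc, hTF z hz, Matrix.mul_assoc]
    have e' := congrFun (congrFun e l) j
    rw [Matrix.diagonal_mul, Matrix.smul_apply, smul_eq_mul] at e'
    rw [sub_mul, e', sub_self]
  -- Differentiating `T F = Λ T` shows that row `l` of `dT` is again a left eigenvector for `λₗ`.
  have h2 : ∀ z ∈ U, ∀ j, (dT z * F z) l j = z.1 l * dT z l j := by
    intro z hz j
    have dT' : ∀ a b, DifferentiableAt ℝ (fun y => T y a b) z := fun a b =>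
      differentiableAt_of_contDiffOn hU (hT a b) hz
    have dF' : ∀ a b, DifferentiableAt ℝ (fun y => F y a b) z := fun a b =>
      differentiableAt_of_contDiffOn hU (hF a b) hz
    have hev : (fun y => ∑ p, T y l p * F y p j) =ᶠ[nhds z] fun y => y.1 l * T y l j := by
      filter_upwards [hU.mem_nhds hz] with y hy
      have := congrFun (congrFun (hTF y hy) l) j
      rwa [Matrix.diagonal_mul, Matrix.mul_apply] at this
    have hdl : DifferentiableAt ℝ (fun y : Phase n => y.1 l) z := by fun_prop
    have hd := fderiv_sum_mul_apply (fun p => dT' l p) (fun p => dF' p j) (pairIncl m w)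
    rw [hev.fderiv_eq, fderiv_fun_mul hdl (dT' l j)] at hd
    have hd' : z.1 l * dT z l j = ∑ p, (T z l p * dF z p j + F z p j * dT z l p) := by
      rw [← show _ = ∑ p, (T z l p * dF z p j + F z p j * dT z l p) from hd]
      simp [fderiv_fst_coord_pairIncl hml, dT]
    have h1' := h1 z hz j
    rw [Matrix.mul_apply] at h1'
    rw [Finset.sum_add_distrib, h1', zero_add] at hd'
    rw [hd', Matrix.mul_apply]
    exact Finset.sum_congr rfl fun p _ => mul_comm _ _
  have hadj : ∀ z ∈ U, F z * (T z).adjugate = (T z).adjugate * Matrix.diagonal z.1 := by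
    intro z hz
    have e : (T z).adjugate * (T z * F z) * (T z).adjugate =
        (T z).adjugate * (Matrix.diagonal z.1 * T z) * (T z).adjugate := by rw [hTF z hz]
    rw [← Matrix.mul_assoc, Matrix.adjugate_mul, ← Matrix.mul_assoc (T z).adjugate,
      Matrix.mul_assoc _ (T z) _, Matrix.mul_adjugate, Matrix.smul_mul, Matrix.one_mul,
      Matrix.smul_mul, Matrix.mul_smul, Matrix.mul_one] at e
    exact smul_right_injective _ (hdet z hz) e
  -- The coefficients of row `l` of `dT` in the basis of rows of `T`, up to the factor `det T`.
  have h3 : ∀ z ∈ U, ∀ p ≠ l, (dT z * (T z).adjugate) l p = 0 := by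
    intro z hz p hp
    have hac : ContinuousOn (fun z => (T z).adjugate) U :=
      continuous_id.matrix_adjugate.comp_continuousOn hTc
    refine eq_zero_of_sub_mul_eq_zero hU (hentry (hmul hdTc hac) l p) hp ?_ z hz
    intro z hz
    have e : (dT z * F z * (T z).adjugate) l p = z.1 l * (dT z * (T z).adjugate) l p := by
      rw [Matrix.mul_apply, Matrix.mul_apply, Finset.mul_sum]
      refine Finset.sum_congr rfl fun q _ => ?_
      rw [h2 z hz q, mul_assoc]
    rw [Matrix.mul_assoc, hadj z hz, ← Matrix.mul_assoc, Matrix.mul_diagonal] at e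
    rw [sub_mul, ← e]
    ring
  have h4 : ∀ j, (T z).det * dT z l j = (dT z * (T z).adjugate) l l * T z l j := by
    intro j
    have e : (dT z * (T z).adjugate * T z) l j = (T z).det * dT z l j := by
      rw [Matrix.mul_assoc, Matrix.adjugate_mul]
      simp
    rw [← e, Matrix.mul_apply, Finset.sum_eq_single l]
    · intro p _ hp
      rw [h3 z hz p hp, zero_mul]
    · simp
  -- The normalization kills the remaining coefficient.
  have h5 : (dT z * (T z).adjugate) l l = 0 := by
    have hconst : (fun y => T y l (k l)) =ᶠ[nhds z] fun _ => c l := by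
      filter_upwards [hU.mem_nhds hz] with y hy using hnorm y hy l
    have h0 : dT z l (k l) = 0 := by
      simp [dT, hconst.fderiv_eq]
    have := h4 (k l)
    rw [h0, mul_zero, hnorm z hz l] at this
    exact (mul_eq_zero.1 this.symm).resolve_right (hc l)
  have := h4 j
  rw [h5, zero_mul] at this
  exact (mul_eq_zero.1 this).resolve_left (hdet z hz)

/-- The matrix `T dC` is diagonal on the pairs: its row `l` vanishes along the pairs with index
`m ≠ l`. -/
theorem sum_row_mul_fderiv_eq_zero (hU : IsOpen U) {F T : Phase n → Matrix (Fin n) (Fin n) ℝ}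
    {C : Fin n → Phase n → ℝ} (hC : ∀ i, ContDiffOn ℝ ∞ (C i) U)
    (hT : ∀ i j, ContDiffOn ℝ ∞ (fun z => T z i j) U)
    (hTF : ∀ z ∈ U, T z * F z = Matrix.diagonal z.1 * T z)
    (hNC : ∀ z ∈ U, ∀ i m w, z.1 m * fderiv ℝ (C i) z (pairIncl m w) =
      ∑ k, F z i k * fderiv ℝ (C k) z (pairIncl m w))
    {l m : Fin n} (hml : m ≠ l) (w : ℝ × ℝ) {z : Phase n} (hz : z ∈ U) :
    ∑ j, T z l j * fderiv ℝ (C j) z (pairIncl m w) = 0 := by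
  refine eq_zero_of_sub_mul_eq_zero (h := fun z => ∑ j, T z l j * fderiv ℝ (C j) z (pairIncl m w))
    hU ?_ hml ?_ z hz
  · exact continuousOn_finsetSum _ fun j _ =>
      (hT l j).continuousOn.mul (continuousOn_fderiv_apply hU (hC j) _)
  intro z hz
  let d : Fin n → ℝ := fun j => fderiv ℝ (C j) z (pairIncl m w)
  have e0 : (F z).mulVec d = z.1 m • d := by
    ext i
    exact (hNC z hz i m w).symm
  have e : (T z * F z).mulVec d l = z.1 m * (T z).mulVec d l := by
    rw [← Matrix.mulVec_mulVec, e0, Matrix.mulVec_smul]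
    rfl
  rw [hTF z hz, ← Matrix.mulVec_mulVec, Matrix.mulVec_diagonal] at e
  change (z.1 m - z.1 l) * (T z).mulVec d l = 0
  rw [sub_mul, e, sub_self]

/-- Each component of `T C` has zero derivative along the pairs with a different index. -/
theorem fderiv_mulVec_eq_zero (hU : IsOpen U) {T : Phase n → Matrix (Fin n) (Fin n) ℝ}
    {C : Fin n → Phase n → ℝ} (hC : ∀ i, ContDiffOn ℝ ∞ (C i) U)
    (hT : ∀ i j, ContDiffOn ℝ ∞ (fun z => T z i j) U) {l : Fin n} {v z : Phase n} (hz : z ∈ U)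
    (hdT : ∀ j, fderiv ℝ (fun y => T y l j) z v = 0)
    (hTC : ∑ j, T z l j * fderiv ℝ (C j) z v = 0) :
    fderiv ℝ (fun y => (T y).mulVec (fun j => C j y) l) z v = 0 := by
  have dT : ∀ j, DifferentiableAt ℝ (fun y => T y l j) z := fun j =>
    differentiableAt_of_contDiffOn hU (hT l j) hz
  have dC : ∀ j, DifferentiableAt ℝ (C j) z := fun j =>
    differentiableAt_of_contDiffOn hU (hC j) hz
  change fderiv ℝ (fun y => ∑ j, T y l j * C j y) z v = 0
  rw [fderiv_sum_mul_apply dT dC, ← hTC]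
  exact Finset.sum_congr rfl fun p _ => by rw [hdT p, mul_zero, add_zero]

end Flat

/-! ### Smoothness of integrals with parameters -/

section Parametric

open MeasureTheory

variable {E G : Type} [NormedAddCommGroup E] [NormedSpace ℝ E] [FiniteDimensional ℝ E]
  [NormedAddCommGroup G] [NormedSpace ℝ G]

/-- Differentiation under the integral sign for a smooth integrand. -/
theorem hasFDerivAt_integral_of_contDiffOn {U : Set E} {V : Set ℝ} (hU : IsOpen U)
    (hV : IsOpen V) (hIV : Set.Icc 0 1 ⊆ V) {f : E × ℝ → G} (hf : ContDiffOn ℝ ∞ f (U ×ˢ V))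
    {x₀ : E} (hx₀ : x₀ ∈ U) :
    HasFDerivAt (fun x => ∫ t in (0 : ℝ)..1, f (x, t))
      (∫ t in (0 : ℝ)..1, (fderiv ℝ f (x₀, t)).comp (ContinuousLinearMap.inl ℝ E ℝ)) x₀ := by
  have hUV : IsOpen (U ×ˢ V) := hU.prod hV
  have hfd : ContinuousOn (fun y : E × ℝ =>
      (fderiv ℝ f y).comp (ContinuousLinearMap.inl ℝ E ℝ)) (U ×ˢ V) :=
    (hf.continuousOn_fderiv_of_isOpen hUV (by simp)).clm_comp continuousOn_const
  obtain ⟨ε, hε, hεU⟩ := Metric.isOpen_iff.1 hU x₀ hx₀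
  have hball : Metric.closedBall x₀ (ε / 2) ⊆ U :=
    (Metric.closedBall_subset_ball (by linarith)).trans hεU
  have : ProperSpace E := FiniteDimensional.proper ℝ E
  have hK : IsCompact (Metric.closedBall x₀ (ε / 2) ×ˢ Set.Icc (0 : ℝ) 1) :=
    (isCompact_closedBall x₀ (ε / 2)).prod isCompact_Icc
  obtain ⟨c, hcb⟩ := hK.exists_bound_of_continuousOn (hfd.mono (Set.prod_mono hball hIV))
  have hslice : ∀ {G' : Type} [TopologicalSpace G'] {g : E × ℝ → G'},
      ContinuousOn g (U ×ˢ V) → ∀ x ∈ U, ContinuousOn (fun t : ℝ => g (x, t)) (Set.Icc 0 1) := by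
    intro G' _ g hg x hx
    exact hg.comp (by fun_prop) fun t ht => ⟨hx, hIV ht⟩
  have hIoc : Set.uIoc (0 : ℝ) 1 ⊆ Set.Icc 0 1 := by
    rw [Set.uIoc_of_le zero_le_one]; exact Set.Ioc_subset_Icc_self
  have hmeas : ∀ {G' : Type} [NormedAddCommGroup G'] {g : ℝ → G'},
      ContinuousOn g (Set.Icc 0 1) →
        AEStronglyMeasurable g (volume.restrict (Set.uIoc (0 : ℝ) 1)) := by
    intro G' _ g hg
    exact (hg.mono hIoc).aestronglyMeasurable measurableSet_uIoc
  refine intervalIntegral.hasFDerivAt_integral_of_dominated_of_fderiv_le (𝕜 := ℝ)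
    (bound := fun _ => c) (s := Metric.closedBall x₀ (ε / 2))
    (F := fun x t => f (x, t))
    (F' := fun x t => (fderiv ℝ f (x, t)).comp (ContinuousLinearMap.inl ℝ E ℝ))
    (Metric.closedBall_mem_nhds x₀ (by positivity)) ?_ ?_ ?_ ?_ ?_ ?_
  · filter_upwards [hU.mem_nhds hx₀] with x hx using hmeas (hslice hf.continuousOn x hx)
  · apply ContinuousOn.intervalIntegrable
    rw [Set.uIcc_of_le zero_le_one]
    exact hslice hf.continuousOn x₀ hx₀
  · exact hmeas (hslice hfd x₀ hx₀)
  · exact Filter.Eventually.of_forall fun t ht x hx => hcb (x, t) ⟨hx, hIoc ht⟩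
  · exact intervalIntegrable_const
  · refine Filter.Eventually.of_forall fun t ht x hx => ?_
    have h1 : HasFDerivAt f (fderiv ℝ f (x, t)) (x, t) :=
      (differentiableAt_of_contDiffOn hUV hf ⟨hball hx, hIV (hIoc ht)⟩).hasFDerivAt
    exact h1.comp x (hasFDerivAt_prodMk_left x t)

end Parametric

/-- Induction on the order of differentiability. Each step replaces the target space `G` by
`E →L[ℝ] G`, so both spaces live in one universe. -/
theorem contDiffOn_nat_integral_of_contDiffOn {E : Type} [NormedAddCommGroup E] [NormedSpace ℝ E]
    [FiniteDimensional ℝ E] {U : Set E} {V : Set ℝ} (hU : IsOpen U) (hV : IsOpen V)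
    (hIV : Set.Icc 0 1 ⊆ V) (m : ℕ) : ∀ {G : Type} [NormedAddCommGroup G] [NormedSpace ℝ G]
    {f : E × ℝ → G}, ContDiffOn ℝ ∞ f (U ×ˢ V) →
      ContDiffOn ℝ m (fun x => ∫ t in (0 : ℝ)..1, f (x, t)) U := by
  induction m with
  | zero =>
    intro G _ _ f hf
    rw [Nat.cast_zero, contDiffOn_zero]
    exact fun x hx =>
      (hasFDerivAt_integral_of_contDiffOn hU hV hIV hf hx).continuousAt.continuousWithinAt
  | succ m ih =>
    intro G _ _ f hf
    rw [Nat.cast_succ, contDiffOn_succ_iff_fderiv_of_isOpen hU]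
    refine ⟨fun x hx => (hasFDerivAt_integral_of_contDiffOn hU hV hIV hf
      hx).differentiableAt.differentiableWithinAt, by simp, ?_⟩
    have hfd : ContDiffOn ℝ ∞ (fun y : E × ℝ =>
        (fderiv ℝ f y).comp (ContinuousLinearMap.inl ℝ E ℝ)) (U ×ˢ V) :=
      ((contDiffOn_infty_iff_fderiv_of_isOpen (hU.prod hV)).1 hf).2.clm_comp contDiffOn_const
    exact (ih hfd).congr fun x hx => (hasFDerivAt_integral_of_contDiffOn hU hV hIV hf hx).fderiv

/-- The primitive in the first variable of a smooth function with parameters is smooth in all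
variables jointly. -/
theorem contDiffOn_primitive {E : Type} [NormedAddCommGroup E] [NormedSpace ℝ E]
    [FiniteDimensional ℝ E] {s₀ r : ℝ} {A : Set E} (hA : IsOpen A)
    {f : ℝ × E → ℝ} (hf : ContDiffOn ℝ ∞ f (Metric.ball s₀ (2 * r) ×ˢ A)) :
    ContDiffOn ℝ ∞ (fun y : ℝ × E => ∫ σ in s₀..y.1, f (σ, y.2)) (Metric.ball s₀ r ×ˢ A) := by
  have key : ∀ y : ℝ × E, ∫ σ in s₀..y.1, f (σ, y.2) =
      ∫ t in (0 : ℝ)..1, (y.1 - s₀) * f (s₀ + (y.1 - s₀) * t, y.2) := by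
    intro y
    have := intervalIntegral.smul_integral_comp_add_mul (a := 0) (b := 1)
      (fun σ => f (σ, y.2)) (y.1 - s₀) s₀
    simp only [mul_zero, add_zero, mul_one, add_sub_cancel, smul_eq_mul] at this
    rw [intervalIntegral.integral_const_mul, this]
  simp_rw [key]
  -- For `|t| < 2` the point `s₀ + (s - s₀) t` stays in the ball of twice the radius.
  refine contDiffOn_infty.2 fun m => contDiffOn_nat_integral_of_contDiffOn
    (f := fun x : (ℝ × E) × ℝ => (x.1.1 - s₀) * f (s₀ + (x.1.1 - s₀) * x.2, x.1.2))
    (Metric.isOpen_ball.prod hA) (V := Metric.ball (0 : ℝ) 2) Metric.isOpen_ball ?_ m ?_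
  · intro t ht
    rw [mem_ball_zero_iff, Real.norm_eq_abs, abs_lt]
    constructor <;> linarith [ht.1, ht.2]
  · refine ContDiffOn.mul (by fun_prop) (hf.comp (by fun_prop) ?_)
    rintro ⟨⟨s, a⟩, t⟩ ⟨⟨hs, ha⟩, ht⟩
    refine ⟨?_, ha⟩
    simp only [Metric.mem_ball, Real.dist_eq, sub_zero, add_sub_cancel_left, abs_mul] at hs ht ⊢
    rw [mul_comm 2 r]
    exact mul_lt_mul'' hs ht (abs_nonneg _) (abs_nonneg _)

/-! ### Passage to coordinates -/

section Coordinates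

variable {n : ℕ} {M : Type*} [TopologicalSpace M] [ChartedSpace (Model n) M]

/-- The tangent vector at `x` with coordinate expression `v` in the chart `φ`. -/
def coordVec (φ : OpenPartialHomeomorph M (Phase n)) (x : M) (v : Phase n) : Tan n x :=
  mfderiv 𝓘(ℝ, Phase n) 𝓘(ℝ, Model n) φ.symm (φ x) v

variable {φ : OpenPartialHomeomorph M (Phase n)} {B : SympBiham n M}

/-- Tangent spaces at equal points are identified through the model space, so derivatives at equal
points agree on every vector of the model space. -/
theorem mfderiv_apply_congr {G : Type*} [NormedAddCommGroup G] [NormedSpace ℝ G] (f : M → G)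
    {x y : M} (h : y = x) (u : Model n) :
    (mfderiv 𝓘(ℝ, Model n) 𝓘(ℝ, G) f y u : G) = mfderiv 𝓘(ℝ, Model n) 𝓘(ℝ, G) f x u := by
  subst h; rfl

namespace IsDarbouxNijenhuis

theorem mdifferentiableAt (hφ : IsDarbouxNijenhuis B φ) {x : M} (hx : x ∈ φ.source) :
    MDifferentiableAt 𝓘(ℝ, Model n) 𝓘(ℝ, Phase n) φ x :=
  (hφ.smooth.contMDiffAt (φ.open_source.mem_nhds hx)).mdifferentiableAt (by simp)

theorem mdifferentiableAt_symm (hφ : IsDarbouxNijenhuis B φ) {z : Phase n} (hz : z ∈ φ.target) :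
    MDifferentiableAt 𝓘(ℝ, Phase n) 𝓘(ℝ, Model n) φ.symm z :=
  (hφ.smooth_symm.contMDiffAt (φ.open_target.mem_nhds hz)).mdifferentiableAt (by simp)

theorem contDiffOn_comp_symm (hφ : IsDarbouxNijenhuis B φ) {f : M → ℝ}
    (hf : ContMDiffOn 𝓘(ℝ, Model n) 𝓘(ℝ, ℝ) ∞ f φ.source) :
    ContDiffOn ℝ ∞ (f ∘ φ.symm) φ.target :=
  contMDiffOn_iff_contDiffOn.1 (hf.comp hφ.smooth_symm fun _ hz => φ.map_target hz)

theorem diffl_coordVec (hφ : IsDarbouxNijenhuis B φ) {f : M → ℝ} {x : M} (hx : x ∈ φ.source)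
    (hf : MDifferentiableAt 𝓘(ℝ, Model n) 𝓘(ℝ, ℝ) f x) (v : Phase n) :
    diffl n f x (coordVec φ x v) = fderiv ℝ (f ∘ φ.symm) (φ x) v := by
  have hd := mfderiv_comp_of_eq hf (hφ.mdifferentiableAt_symm (φ.map_source hx)) (φ.left_inv hx)
  rw [mfderiv_eq_fderiv] at hd
  exact ((DFunLike.congr_fun hd v).trans (mfderiv_apply_congr f (φ.left_inv hx) _)).symm

theorem diffl_lam (hφ : IsDarbouxNijenhuis B φ) {x : M} (hx : x ∈ φ.source) (i : Fin n)
    (u : Tan n x) :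
    diffl n (lam φ i) x u = (mfderiv 𝓘(ℝ, Model n) 𝓘(ℝ, Phase n) φ x u : Phase n).1 i := by
  let L : Phase n →L[ℝ] ℝ :=
    (ContinuousLinearMap.proj i).comp (ContinuousLinearMap.fst ℝ (Fin n → ℝ) (Fin n → ℝ))
  have hd := mfderiv_comp x (g := L) L.differentiableAt.mdifferentiableAt (hφ.mdifferentiableAt hx)
  rw [mfderiv_eq_fderiv, L.fderiv] at hd
  exact DFunLike.congr_fun hd u

theorem diffl_mu (hφ : IsDarbouxNijenhuis B φ) {x : M} (hx : x ∈ φ.source) (i : Fin n)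
    (u : Tan n x) :
    diffl n (mu φ i) x u = (mfderiv 𝓘(ℝ, Model n) 𝓘(ℝ, Phase n) φ x u : Phase n).2 i := by
  let L : Phase n →L[ℝ] ℝ :=
    (ContinuousLinearMap.proj i).comp (ContinuousLinearMap.snd ℝ (Fin n → ℝ) (Fin n → ℝ))
  have hd := mfderiv_comp x (g := L) L.differentiableAt.mdifferentiableAt (hφ.mdifferentiableAt hx)
  rw [mfderiv_eq_fderiv, L.fderiv] at hd
  exact DFunLike.congr_fun hd u

theorem mfderiv_coordVec (hφ : IsDarbouxNijenhuis B φ) {x : M} (hx : x ∈ φ.source) (v : Phase n) :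
    mfderiv 𝓘(ℝ, Model n) 𝓘(ℝ, Phase n) φ x (coordVec φ x v) = v := by
  have hd := mfderiv_comp_of_eq (hφ.mdifferentiableAt hx)
    (hφ.mdifferentiableAt_symm (φ.map_source hx)) (φ.left_inv hx)
  have hev : (φ ∘ φ.symm) =ᶠ[nhds (φ x)] id := by
    filter_upwards [φ.open_target.mem_nhds (φ.map_source hx)] with z hz using φ.right_inv hz
  rw [hev.mfderiv_eq, mfderiv_id] at hd
  exact ((DFunLike.congr_fun hd v).trans (mfderiv_apply_congr φ (φ.left_inv hx) _)).symm

theorem mfderiv_injective (hφ : IsDarbouxNijenhuis B φ) {x : M} (hx : x ∈ φ.source) :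
    Function.Injective (mfderiv 𝓘(ℝ, Model n) 𝓘(ℝ, Phase n) φ x) := by
  have hd := mfderiv_comp x (hφ.mdifferentiableAt_symm (φ.map_source hx)) (hφ.mdifferentiableAt hx)
  have hev : (φ.symm ∘ φ) =ᶠ[nhds x] id := by
    filter_upwards [φ.open_source.mem_nhds hx] with z hz using φ.left_inv hz
  rw [hev.mfderiv_eq, mfderiv_id] at hd
  exact Function.LeftInverse.injective (g := mfderiv 𝓘(ℝ, Phase n) 𝓘(ℝ, Model n) φ.symm (φ x))
    fun u => (DFunLike.congr_fun hd u).symm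

/-- The plane spanned by `∂/∂λₘ` and `∂/∂μₘ` consists of eigenvectors of `N` for `λₘ`. -/
theorem N_coordVec_pairIncl (hφ : IsDarbouxNijenhuis B φ) {x : M} (hx : x ∈ φ.source) (m : Fin n)
    (w : ℝ × ℝ) :
    B.N x (coordVec φ x (pairIncl m w)) = (φ x).1 m • coordVec φ x (pairIncl m w) := by
  apply hφ.mfderiv_injective hx
  have hs : ∀ (i : Fin n) (a : ℝ), (φ x).1 i * (Pi.single m a : Fin n → ℝ) i =
      (φ x).1 m * (Pi.single m a : Fin n → ℝ) i := by
    intro i a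
    rcases eq_or_ne i m with rfl | h
    · rfl
    · simp [Pi.single_eq_of_ne h]
  have h1 : ∀ i, diffl n (lam φ i) x (B.N x (coordVec φ x (pairIncl m w))) =
      diffl n (lam φ i) x ((φ x).1 m • coordVec φ x (pairIncl m w)) := by
    intro i
    have h := LinearMap.congr_fun (hφ.Nstar_lam x hx i) (coordVec φ x (pairIncl m w))
    rw [map_smul]
    refine h.trans ?_
    rw [LinearMap.smul_apply, hφ.diffl_lam hx, hφ.mfderiv_coordVec hx]
    exact hs i w.1
  have h2 : ∀ i, diffl n (mu φ i) x (B.N x (coordVec φ x (pairIncl m w))) =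
      diffl n (mu φ i) x ((φ x).1 m • coordVec φ x (pairIncl m w)) := by
    intro i
    have h := LinearMap.congr_fun (hφ.Nstar_mu x hx i) (coordVec φ x (pairIncl m w))
    rw [map_smul]
    refine h.trans ?_
    rw [LinearMap.smul_apply, hφ.diffl_mu hx, hφ.mfderiv_coordVec hx]
    exact hs i w.2
  simp only [hφ.diffl_lam hx] at h1
  simp only [hφ.diffl_mu hx] at h2
  exact Prod.ext (funext h1) (funext h2)

end IsDarbouxNijenhuis

theorem SympBiham.flat_P₀ (x : M) (β : Cotan n x) : B.flat x (B.P₀ x β) = β :=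
  (LinearEquiv.ofBijective (B.P₀ x) (B.nondeg x)).symm_apply_apply β

/-- The relation `N X_C = F X_C` between Hamiltonian vector fields gives
`N* dC = F dC`, because `P₀` and `P₁ = N P₀` are both skew-symmetric. -/
theorem SympBiham.diffl_N_eq {C : Fin n → M → ℝ} {x : M} {i : Fin n} {a : Fin n → ℝ}
    (h : B.N x (B.hamVF (C i) x) = ∑ j, a j • B.hamVF (C j) x) (v : Tan n x) :
    diffl n (C i) x (B.N x v) = ∑ j, a j * diffl n (C j) x v := by
  obtain ⟨β, rfl⟩ := (B.nondeg x).2 v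
  have skew₁ : ∀ α γ : Cotan n x, α (B.P₁ x γ) = -γ (B.P₁ x α) := by
    intro α γ
    have := (B.pencil 0).skew x α γ
    simpa using this
  have hN : ∀ γ, B.N x (B.P₀ x γ) = B.P₁ x γ := fun γ => by
    rw [SympBiham.N, LinearMap.comp_apply, B.flat_P₀]
  rw [SympBiham.hamVF, hN] at h
  have h' := congrArg β h
  rw [hN, skew₁, h', map_sum, ← Finset.sum_neg_distrib]
  refine Finset.sum_congr rfl fun j _ => ?_
  rw [map_smul, smul_eq_mul, SympBiham.hamVF, B.poisson₀.skew x β, mul_neg, neg_neg]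

end Coordinates

/-! ### Functions of one pair of coordinates -/

/-- Only the derivative in the direction of the segment has to vanish. -/
theorem eq_of_fderiv_sub_eq_zero {E : Type*} [NormedAddCommGroup E] [NormedSpace ℝ E] {U : Set E}
    (hU : Convex ℝ U) {f : E → ℝ} (hf : ∀ z ∈ U, DifferentiableAt ℝ f z) {x y : E} (hx : x ∈ U)
    (hy : y ∈ U) (h : ∀ z ∈ U, fderiv ℝ f z (y - x) = 0) : f y = f x := by
  have hmem : ∀ t ∈ Set.Icc (0 : ℝ) 1, AffineMap.lineMap x y t ∈ U := fun t ht =>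
    hU.lineMap_mem hx hy ht
  have hd : ∀ t ∈ Set.Icc (0 : ℝ) 1, HasDerivAt (fun t : ℝ => f (AffineMap.lineMap x y t)) 0 t := by
    intro t ht
    have := (hf _ (hmem t ht)).hasFDerivAt.comp_hasDerivAt t
      (AffineMap.hasDerivAt_lineMap (a := x) (b := y))
    rwa [h _ (hmem t ht)] at this
  have := constant_of_has_deriv_right_zero
    (fun t ht => (hd t ht).continuousAt.continuousWithinAt)
    (fun t ht => (hd t (Set.Ico_subset_Icc_self ht)).hasDerivWithinAt) 1 (by simp)
  simpa using this

/-- The pair of coordinates with index `i`. -/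
def pairProj {n : ℕ} (i : Fin n) (z : Phase n) : ℝ × ℝ := (z.1 i, z.2 i)

theorem pairProj_add_pairIncl {n : ℕ} (i : Fin n) (z : Phase n) (w : ℝ × ℝ) :
    pairProj i (z + pairIncl i (w - pairProj i z)) = w := by
  simp [pairProj]

theorem norm_pairIncl_le {n : ℕ} (i : Fin n) (w : ℝ × ℝ) : ‖pairIncl i w‖ ≤ ‖w‖ := by
  rw [Prod.norm_def, Prod.norm_def, pairIncl_fst, pairIncl_snd, Pi.norm_single, Pi.norm_single]

theorem norm_pairProj_sub_le {n : ℕ} (i : Fin n) (z z' : Phase n) :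
    ‖pairProj i z - pairProj i z'‖ ≤ ‖z - z'‖ :=
  max_le_max (norm_le_pi_norm (z.1 - z'.1) i) (norm_le_pi_norm (z.2 - z'.2) i)

theorem apply_eq_zero_of_pairProj_eq_zero {n : ℕ} {i : Fin n} {L : Phase n →L[ℝ] ℝ}
    (hL : ∀ m, m ≠ i → ∀ w, L (pairIncl m w) = 0) {v : Phase n} (hv : pairProj i v = 0) :
    L v = 0 := by
  have hsum : v = ∑ m, pairIncl m (pairProj m v) := by
    refine Prod.ext ?_ ?_
    · rw [Prod.fst_sum]
      exact (Finset.univ_sum_single v.1).symm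
    · rw [Prod.snd_sum]
      exact (Finset.univ_sum_single v.2).symm
  rw [hsum, map_sum]
  refine Finset.sum_eq_zero fun m _ => ?_
  rcases eq_or_ne m i with rfl | hm
  · rw [hv, map_zero, map_zero]
  · exact hL m hm _

/-- On a ball, a function whose derivative vanishes along all pairs but one is determined by its
restriction to the plane of that pair through the centre. -/
theorem eq_apply_add_pairIncl {n : ℕ} {i : Fin n} {G : Phase n → ℝ} {z₀ : Phase n} {r : ℝ}
    (hG : ∀ z ∈ Metric.ball z₀ r, DifferentiableAt ℝ G z)
    (hG0 : ∀ z ∈ Metric.ball z₀ r, ∀ m, m ≠ i → ∀ w, fderiv ℝ G z (pairIncl m w) = 0)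
    {z : Phase n} (hz : z ∈ Metric.ball z₀ r) :
    G z = G (z₀ + pairIncl i (pairProj i z - pairProj i z₀)) := by
  refine eq_of_fderiv_sub_eq_zero (convex_ball z₀ r) hG ?_ hz fun y hy =>
    apply_eq_zero_of_pairProj_eq_zero (hG0 y hy) ?_
  · rw [mem_ball_iff_norm, add_sub_cancel_left]
    exact ((norm_pairIncl_le _ _).trans (norm_pairProj_sub_le _ _ _)).trans_lt
      (mem_ball_iff_norm.1 hz)
  · simp [pairProj]

section DependsOnlyOnPair

variable {n : ℕ} {M : Type*} [TopologicalSpace M]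
  {φ : OpenPartialHomeomorph M (Phase n)} {i : Fin n} {g : M → ℝ}

/-- Local factorization through the `i`-th pair, on a neighbourhood `V'` inside a prescribed one.
The values of the pair on `V'` form an open set, which lets local factorizations be glued. -/
theorem exists_factorsThroughPair_nhds (hg : ContDiffOn ℝ ∞ (g ∘ φ.symm) φ.target)
    (hg0 : ∀ z ∈ φ.target, ∀ m, m ≠ i → ∀ w, fderiv ℝ (g ∘ φ.symm) z (pairIncl m w) = 0)
    {V : Set M} (hV : IsOpen V) (hVs : V ⊆ φ.source) {x : M} (hx : x ∈ V) :
    ∃ V' : Set M, IsOpen V' ∧ x ∈ V' ∧ V' ⊆ V ∧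
      IsOpen ((fun y => (lam φ i y, mu φ i y)) '' V') ∧ FactorsThroughPair φ i g V' := by
  have hopen : IsOpen (φ.target ∩ φ.symm ⁻¹' V) := φ.symm.isOpen_inter_preimage hV
  have hxm : φ x ∈ φ.target ∩ φ.symm ⁻¹' V :=
    ⟨φ.map_source (hVs hx), by rwa [Set.mem_preimage, φ.left_inv (hVs hx)]⟩
  obtain ⟨r, hr, hb⟩ := Metric.isOpen_iff.1 hopen _ hxm
  have himg : (fun y => (lam φ i y, mu φ i y)) '' (φ.source ∩ φ ⁻¹' Metric.ball (φ x) r) =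
      Metric.ball (pairProj i (φ x)) r := by
    ext w
    constructor
    · rintro ⟨y, hy, rfl⟩
      rw [mem_ball_iff_norm]
      exact (norm_pairProj_sub_le i (φ y) (φ x)).trans_lt (mem_ball_iff_norm.1 hy.2)
    · intro hw
      have hz : φ x + pairIncl i (w - pairProj i (φ x)) ∈ Metric.ball (φ x) r := by
        rw [mem_ball_iff_norm, add_sub_cancel_left]
        exact (norm_pairIncl_le _ _).trans_lt (mem_ball_iff_norm.1 hw)
      have hr := φ.right_inv (hb hz).1
      refine ⟨φ.symm (φ x + pairIncl i (w - pairProj i (φ x))),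
        ⟨φ.map_target (hb hz).1, by rwa [Set.mem_preimage, hr]⟩, ?_⟩
      change pairProj i (φ (φ.symm _)) = w
      rw [hr, pairProj_add_pairIncl]
  refine ⟨φ.source ∩ φ ⁻¹' Metric.ball (φ x) r, φ.isOpen_inter_preimage Metric.isOpen_ball,
    ⟨hVs hx, Metric.mem_ball_self hr⟩, ?_, ?_,
    fun w => (g ∘ φ.symm) (φ x + pairIncl i (w - pairProj i (φ x))), ?_, ?_⟩
  · rintro y ⟨hy, hyb⟩
    have := (hb hyb).2
    rwa [Set.mem_preimage, φ.left_inv hy] at this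
  · rw [himg]
    exact Metric.isOpen_ball
  · rw [himg]
    refine hg.comp (by fun_prop) fun w hw => (hb ?_).1
    rw [mem_ball_iff_norm, add_sub_cancel_left]
    exact (norm_pairIncl_le _ _).trans_lt (mem_ball_iff_norm.1 hw)
  · rintro y ⟨hy, hyb⟩
    have h := eq_apply_add_pairIncl (i := i) (G := g ∘ φ.symm) (z₀ := φ x) (r := r)
      (fun z hz => differentiableAt_of_contDiffOn φ.open_target hg (hb hz).1)
      (fun z hz => hg0 z (hb hz).1) hyb
    rw [Function.comp_apply, φ.left_inv hy] at h
    exact h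

/-- A smooth function whose derivative vanishes along all pairs but the `i`-th depends only on the
`i`-th pair of coordinates. -/
theorem dependsOnlyOnPair_of_fderiv_eq_zero (hg : ContDiffOn ℝ ∞ (g ∘ φ.symm) φ.target)
    (hg0 : ∀ z ∈ φ.target, ∀ m, m ≠ i → ∀ w, fderiv ℝ (g ∘ φ.symm) z (pairIncl m w) = 0) :
    DependsOnlyOnPair φ i g := by
  constructor
  · intro x hx
    obtain ⟨V', h1, h2, h3, -, h5⟩ := exists_factorsThroughPair_nhds hg hg0 φ.open_source le_rfl hx
    exact ⟨V', h1, h2, h3, h5⟩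
  · intro V hV hVs hconn
    let p : M → ℝ × ℝ := fun y => (lam φ i y, mu φ i y)
    have hconst : ∀ x ∈ V, ∀ y ∈ V, p x = p y → g x = g y := by
      intro x hx y hy hxy
      have hlam : lam φ i x = lam φ i y := congrArg Prod.fst hxy
      have hmu : mu φ i x = mu φ i y := congrArg Prod.snd hxy
      refine (hconn (lam φ i y) (mu φ i y)).induction₂ (fun a b => g a = g b) ?_
        (fun _ _ _ _ _ _ h h' => h.trans h') (fun _ _ _ _ h => h.symm)
        ⟨hx, hlam, hmu⟩ ⟨hy, rfl, rfl⟩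
      rintro a ⟨ha, hal, ham⟩
      obtain ⟨V', h1, h2, -, -, u, -, hu⟩ := exists_factorsThroughPair_nhds hg hg0 hV hVs ha
      filter_upwards [mem_nhdsWithin_of_mem_nhds (h1.mem_nhds h2), self_mem_nhdsWithin]
        with b hb ⟨_, hbl, hbm⟩
      rw [hu a h2, hu b hb, hal, ham, hbl, hbm]
    -- The global function takes the common value of `g` on each level set in `V`.
    refine ⟨Function.extend (fun y : V => p y) (fun y : V => g y) 0, ?_, ?_⟩
    swap
    · intro x hx
      have hfac : Function.FactorsThrough (fun y : V => g y) (fun y : V => p y) :=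
        fun a b hab => hconst a a.2 b b.2 hab
      exact (hfac.extend_apply 0 ⟨x, hx⟩).symm
    · rintro _ ⟨x, hx, rfl⟩
      have hfac : Function.FactorsThrough (fun y : V => g y) (fun y : V => p y) :=
        fun a b hab => hconst a a.2 b b.2 hab
      obtain ⟨V', h1, h2, h3, h4, u, hus, hu⟩ := exists_factorsThroughPair_nhds hg hg0 hV hVs hx
      refine ((hus.contDiffAt (h4.mem_nhds ⟨x, h2, rfl⟩)).congr_of_eventuallyEq ?_).contDiffWithinAt
      filter_upwards [h4.mem_nhds ⟨x, h2, rfl⟩] with w hw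
      obtain ⟨y, hy, rfl⟩ := hw
      exact (hfac.extend_apply 0 ⟨y, h3 hy⟩).trans (hu y hy)

end DependsOnlyOnPair

/-! ### Separation of the Hamilton–Jacobi equations -/

section Separation

variable {n : ℕ} {U : Set (Phase n)} {C : Fin n → Phase n → ℝ}

theorem continuousOn_momentumJacobian (hU : IsOpen U) (hC : ∀ i, ContDiffOn ℝ ∞ (C i) U) :
    ContinuousOn (momentumJacobian C) U :=
  continuousOn_pi.2 fun j => continuousOn_pi.2 fun _ => continuousOn_fderiv_apply hU (hC j) _

theorem momentumJacobian_mulVec (z : Phase n) (b : Fin n → ℝ) (j : Fin n) :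
    (momentumJacobian C z).mulVec b j = fderiv ℝ (C j) z (0, b) := by
  have hb : ((0, b) : Phase n) = ∑ i, b i • ((0, Pi.single i 1) : Phase n) := by
    refine Prod.ext ?_ ?_
    · simp [Prod.fst_sum]
    · ext j
      simp [Prod.snd_sum, Finset.sum_apply, Pi.single_apply]
  rw [hb, map_sum]
  change ∑ i, momentumJacobian C z j i * b i = _
  refine Finset.sum_congr rfl fun i _ => ?_
  rw [map_smul, smul_eq_mul, mul_comm]
  rfl

/-- The equations `C(q, p) = a` can be solved smoothly for `p = w(q, a)` near a point where the
momentum Jacobian is invertible. -/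
theorem exists_momentum_of_det_ne_zero (hU : IsOpen U) (hC : ∀ i, ContDiffOn ℝ ∞ (C i) U)
    {z₀ : Phase n} (hz₀ : z₀ ∈ U) (hdet : (momentumJacobian C z₀).det ≠ 0) :
    ∃ (w : Phase n → Fin n → ℝ) (Y : Set (Phase n)), IsOpen Y ∧ (z₀.1, fun j => C j z₀) ∈ Y ∧
      w (z₀.1, fun j => C j z₀) = z₀.2 ∧ ContDiffOn ℝ ∞ w Y ∧
      ∀ y ∈ Y, (y.1, w y) ∈ U ∧ (momentumJacobian C (y.1, w y)).det ≠ 0 ∧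
        ∀ j, C j (y.1, w y) = y.2 j := by
  let Ψ : Phase n → Phase n := fun z => (z.1, fun j => C j z)
  have hΨ : ContDiffOn ℝ ∞ Ψ U := contDiffOn_fst.prodMk (contDiffOn_pi.2 hC)
  let L : Phase n → Phase n →L[ℝ] Phase n := fun z =>
    (ContinuousLinearMap.fst ℝ (Fin n → ℝ) (Fin n → ℝ)).prod
      (ContinuousLinearMap.pi fun j => fderiv ℝ (C j) z)
  have hΨ' : ∀ z ∈ U, HasFDerivAt Ψ (L z) z := fun z hz =>
    hasFDerivAt_fst.prodMk (hasFDerivAt_pi.2 fun j =>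
      (differentiableAt_of_contDiffOn hU (hC j) hz).hasFDerivAt)
  have hinj : ∀ z, (momentumJacobian C z).det ≠ 0 → Function.Injective (L z) := by
    intro z hz
    rw [injective_iff_map_eq_zero]
    rintro ⟨a, b⟩ hab
    obtain rfl : a = 0 := congrArg Prod.fst hab
    have hb : (momentumJacobian C z).mulVec b = 0 := by
      ext j
      rw [momentumJacobian_mulVec]
      exact congrFun (congrArg Prod.snd hab) j
    rw [Matrix.eq_zero_of_mulVec_eq_zero hz hb]
    rfl
  have hequiv : ∀ z, (momentumJacobian C z).det ≠ 0 →
      ∃ e : Phase n ≃L[ℝ] Phase n, (e : Phase n →L[ℝ] Phase n) = L z := fun z hz =>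
    ⟨(LinearEquiv.ofInjectiveEndo (L z : Phase n →ₗ[ℝ] Phase n) (hinj z hz)).toContinuousLinearEquiv,
      rfl⟩
  obtain ⟨e₀, he₀⟩ := hequiv z₀ hdet
  have hc₀ : ContDiffAt ℝ ∞ Ψ z₀ := hΨ.contDiffAt (hU.mem_nhds hz₀)
  let e := hc₀.toOpenPartialHomeomorph Ψ (f' := e₀) (he₀ ▸ hΨ' z₀ hz₀) (by simp)
  have hes : z₀ ∈ e.source := hc₀.mem_toOpenPartialHomeomorph_source _ _
  have hU' : IsOpen (U ∩ {z | (momentumJacobian C z).det ≠ 0}) :=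
    (continuous_id.matrix_det.comp_continuousOn
      (continuousOn_momentumJacobian hU hC)).isOpen_inter_preimage hU isOpen_compl_singleton
  have hright : ∀ y ∈ e.target, Ψ (e.symm y) = y := fun y hy => e.right_inv hy
  have hpair : ∀ y ∈ e.target, (y.1, (e.symm y).2) = e.symm y := fun y hy =>
    Prod.ext (congrArg Prod.fst (hright y hy)).symm rfl
  have hleft : e.symm (Ψ z₀) = z₀ := e.left_inv hes
  refine ⟨fun y => (e.symm y).2, e.target ∩ e.symm ⁻¹' (U ∩ {z | (momentumJacobian C z).det ≠ 0}),
    e.symm.isOpen_inter_preimage hU', ⟨e.map_source hes, ?_⟩, congrArg Prod.snd hleft, ?_, ?_⟩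
  · rw [Set.mem_preimage]
    exact hleft.symm ▸ ⟨hz₀, hdet⟩
  · intro y hy
    obtain ⟨e', he'⟩ := hequiv _ hy.2.2
    have hs : ContDiffAt ℝ ∞ e.symm y :=
      e.contDiffAt_symm (f₀' := e') hy.1 (he' ▸ hΨ' _ hy.2.1)
        (hΨ.contDiffAt (hU.mem_nhds hy.2.1))
    exact (contDiffAt_snd.comp y hs).contDiffWithinAt
  · intro y hy
    rw [hpair y hy.1]
    exact ⟨hy.2.1, hy.2.2, fun j => congrFun (congrArg Prod.snd (hright y hy.1)) j⟩

/-- The identity `C(q, w(q, a)) = a`, differentiated in the direction `v` of the variables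
`(q, a)`. -/
theorem fderiv_apply_momentum (hU : IsOpen U) (hC : ∀ i, ContDiffOn ℝ ∞ (C i) U)
    {w : Phase n → Fin n → ℝ} {Y : Set (Phase n)} (hY : IsOpen Y) (hw : ContDiffOn ℝ ∞ w Y)
    (hwU : ∀ y ∈ Y, (y.1, w y) ∈ U) (hCw : ∀ y ∈ Y, ∀ j, C j (y.1, w y) = y.2 j)
    {y : Phase n} (hy : y ∈ Y) (v : Phase n) (j : Fin n) :
    fderiv ℝ (C j) (y.1, w y) (v.1, fderiv ℝ w y v) = v.2 j := by
  have h1 : HasFDerivAt (fun y : Phase n => C j (y.1, w y))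
      ((fderiv ℝ (C j) (y.1, w y)).comp
        ((ContinuousLinearMap.fst ℝ (Fin n → ℝ) (Fin n → ℝ)).prod (fderiv ℝ w y))) y :=
    HasFDerivAt.comp y (differentiableAt_of_contDiffOn hU (hC j) (hwU y hy)).hasFDerivAt
      (hasFDerivAt_fst.prodMk (differentiableAt_of_contDiffOn hY hw hy).hasFDerivAt)
  have h2 : HasFDerivAt (fun y : Phase n => y.2 j)
      ((ContinuousLinearMap.proj j).comp (ContinuousLinearMap.snd ℝ (Fin n → ℝ) (Fin n → ℝ))) y :=
    ((ContinuousLinearMap.proj j).comp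
      (ContinuousLinearMap.snd ℝ (Fin n → ℝ) (Fin n → ℝ))).hasFDerivAt
  have hev : (fun y : Phase n => C j (y.1, w y)) =ᶠ[nhds y] fun y => y.2 j := by
    filter_upwards [hY.mem_nhds hy] with y' hy' using hCw y' hy' j
  exact DFunLike.congr_fun (h1.unique (h2.congr_of_eventuallyEq hev)) v

/-- The momentum `wₗ(q, a)` does not depend on the coordinates `q_m` with `m ≠ l`, because `T dC` is
diagonal on the pairs with invertible momentum part. -/
theorem fderiv_momentum_eq_zero {T : Matrix (Fin n) (Fin n) ℝ} (hT : T.det ≠ 0) {z : Phase n}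
    (hdet : (momentumJacobian C z).det ≠ 0) {l : Fin n}
    (hTC : ∀ m, m ≠ l → ∀ w, ∑ j, T l j * fderiv ℝ (C j) z (pairIncl m w) = 0)
    {d b : Fin n → ℝ} (hd : d l = 0) (hdb : ∀ j, fderiv ℝ (C j) z (d, b) = 0) : b l = 0 := by
  let L : Phase n →L[ℝ] ℝ := ∑ j, T l j • fderiv ℝ (C j) z
  have hL : ∀ v, L v = ∑ j, T l j * fderiv ℝ (C j) z v := fun v => by
    simp [L, _root_.sum_apply]
  have hL0 : ∀ m, m ≠ l → ∀ w, L (pairIncl m w) = 0 := fun m hm w => by rw [hL, hTC m hm w]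
  have h1 : L (((d, b) : Phase n) - b l • pairIncl l (0, 1)) = 0 := by
    apply apply_eq_zero_of_pairProj_eq_zero hL0
    simp [pairProj, hd]
  have h2 : L (d, b) = 0 := by
    rw [hL]
    exact Finset.sum_eq_zero fun j _ => by rw [hdb j, mul_zero]
  rw [map_sub, h2, map_smul, zero_sub, neg_eq_zero, smul_eq_mul] at h1
  refine (mul_eq_zero.1 h1).resolve_right fun h0 => ?_
  -- Otherwise the `l`-th row of the invertible matrix `T ∂C/∂p` would vanish.
  have hrow : ∀ p, (T * momentumJacobian C z) l p = 0 := by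
    intro p
    have hp : (T * momentumJacobian C z) l p = L (pairIncl p (0, 1)) := by
      rw [hL, Matrix.mul_apply]
      have : pairIncl p (0, 1) = ((0, Pi.single p 1) : Phase n) :=
        Prod.ext (Pi.single_zero p) rfl
      rw [this]
      rfl
    rw [hp]
    rcases eq_or_ne p l with rfl | hne
    · exact h0
    · exact hL0 p hne _
  have := Matrix.det_eq_zero_of_row_eq_zero l hrow
  rw [Matrix.det_mul] at this
  exact mul_ne_zero hT hdet this

theorem hasDerivAt_primitive {s₀ r : ℝ} {f : ℝ → ℝ} (hf : ContinuousOn f (Metric.ball s₀ r))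
    {s : ℝ} (hs : s ∈ Metric.ball s₀ r) :
    HasDerivAt (fun t => ∫ σ in s₀..t, f σ) (f s) s := by
  have hs₀ : s₀ ∈ Metric.ball s₀ r := Metric.mem_ball_self (dist_nonneg.trans_lt hs)
  have hsub : Set.uIcc s₀ s ⊆ Metric.ball s₀ r := by
    rw [← segment_eq_uIcc]
    exact (convex_ball s₀ r).segment_subset hs₀ hs
  exact intervalIntegral.integral_hasDerivAt_right (hf.mono hsub).intervalIntegrable
    (hf.stronglyMeasurableAtFilter Metric.isOpen_ball s hs)
    (hf.continuousAt (Metric.isOpen_ball.mem_nhds hs))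

theorem gradQ_sum_eq {f W : Fin n → ℝ × (Fin n → ℝ) → ℝ} {q a : Fin n → ℝ}
    (hW : ∀ i, HasDerivAt (fun s => W i (s, a)) (f i (q i, a)) (q i)) :
    gradQ (fun y => ∑ i, W i (y.1 i, y.2)) q a = fun i => f i (q i, a) := by
  have hd : HasFDerivAt (fun q' : Fin n → ℝ => ∑ i, W i (q' i, a))
      (∑ i, f i (q i, a) • (ContinuousLinearMap.proj i : (Fin n → ℝ) →L[ℝ] ℝ)) q :=
    HasFDerivAt.fun_sum fun i _ =>
      HasDerivAt.comp_hasFDerivAt (h₂ := fun s => W i (s, a)) q (hW i) (hasFDerivAt_apply i q)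
  ext i
  change fderiv ℝ (fun q' : Fin n → ℝ => ∑ i, W i (q' i, a)) q (Pi.single i 1) = _
  rw [hd.fderiv, _root_.sum_apply, Finset.sum_eq_single i]
  · simp
  · intro m _ hm
    simp [Pi.single_eq_of_ne hm]
  · simp

/-- If `T dC` is diagonal on the pairs for some invertible matrices `T`, then the Hamilton–Jacobi
equations of the `C_j` separate: the momenta solving `C(q, p) = a` are functions
`pᵢ = wᵢ(qᵢ, a)`, whose primitives in `qᵢ` add up to a complete integral. -/
theorem hjSeparatesAt_of_sum_mul_fderiv_eq_zero (hU : IsOpen U)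
    (hC : ∀ i, ContDiffOn ℝ ∞ (C i) U) {T : Phase n → Matrix (Fin n) (Fin n) ℝ}
    (hT : ∀ z ∈ U, (T z).det ≠ 0)
    (hTC : ∀ z ∈ U, ∀ l m, m ≠ l → ∀ w, ∑ j, T z l j * fderiv ℝ (C j) z (pairIncl m w) = 0)
    {z₀ : Phase n} (hz₀ : z₀ ∈ U) (hdet : (momentumJacobian C z₀).det ≠ 0) :
    HJSeparatesAt C U z₀ := by
  obtain ⟨w, Y, hY, hyY, hw₀, hw, hwY⟩ := exists_momentum_of_det_ne_zero hU hC hz₀ hdet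
  have hwU : ∀ y ∈ Y, (y.1, w y) ∈ U := fun y hy => (hwY y hy).1
  have hCw : ∀ y ∈ Y, ∀ j, C j (y.1, w y) = y.2 j := fun y hy => (hwY y hy).2.2
  have hwd : ∀ y ∈ Y, DifferentiableAt ℝ w y := fun y hy => differentiableAt_of_contDiffOn hY hw hy
  set q₀ := z₀.1
  set a₀ : Fin n → ℝ := fun j => C j z₀
  obtain ⟨ρ, hρ, hball⟩ := Metric.isOpen_iff.1 hY _ hyY
  obtain ⟨r, hr, rfl⟩ : ∃ r : ℝ, 0 < r ∧ ρ = 2 * r := ⟨ρ / 2, by positivity, by ring⟩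
  have hball' : ∀ q ∈ Metric.ball q₀ (2 * r), ∀ a ∈ Metric.ball a₀ r,
      (q, a) ∈ Metric.ball (q₀, a₀) (2 * r) := by
    intro q hq a ha
    rw [← ball_prod_same]
    exact ⟨hq, Metric.ball_subset_ball (by linarith) ha⟩
  let line : Fin n → ℝ → Fin n → ℝ := fun i s => q₀ + Pi.single i (s - q₀ i)
  have hline : ∀ i, ∀ s ∈ Metric.ball (q₀ i) (2 * r), line i s ∈ Metric.ball q₀ (2 * r) := by
    intro i s hs
    rwa [mem_ball_iff_norm, add_sub_cancel_left, Pi.norm_single, ← mem_ball_iff_norm]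
  let f : Fin n → ℝ × (Fin n → ℝ) → ℝ := fun i x => w (line i x.1, x.2) i
  have hf : ∀ i, ContDiffOn ℝ ∞ (f i) (Metric.ball (q₀ i) (2 * r) ×ˢ Metric.ball a₀ r) := by
    intro i
    have hwi : ContDiffOn ℝ ∞ (fun y => w y i) Y := contDiffOn_pi.1 hw i
    have hsingle : ContDiff ℝ ∞ (fun t : ℝ => (Pi.single i t : Fin n → ℝ)) :=
      (ContinuousLinearMap.single ℝ (fun _ : Fin n => ℝ) i).contDiff
    have hl : ContDiff ℝ ∞ (fun x : ℝ × (Fin n → ℝ) => (line i x.1, x.2)) :=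
      (contDiff_const.add (hsingle.comp (contDiff_fst.sub contDiff_const))).prodMk contDiff_snd
    exact hwi.comp hl.contDiffOn fun x hx => hball (hball' _ (hline i _ hx.1) _ hx.2)
  -- The `i`-th momentum depends on `q` through `qᵢ` only.
  have hwf : ∀ q ∈ Metric.ball q₀ (2 * r), ∀ a ∈ Metric.ball a₀ r, ∀ i,
      w (q, a) i = f i (q i, a) := by
    intro q hq a ha i
    have hqi : q i ∈ Metric.ball (q₀ i) (2 * r) :=
      (dist_le_pi_dist q q₀ i).trans_lt hq
    refine eq_of_fderiv_sub_eq_zero (convex_ball (q₀, a₀) (2 * r)) (f := fun y => w y i)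
      (fun z hz => differentiableAt_pi.1 (hwd z (hball hz)) i)
      (hball' _ (hline i _ hqi) a ha) (hball' q hq a ha) fun y hy => ?_
    have hyY := hball hy
    rw [fderiv_apply (hwd y hyY)]
    refine fderiv_momentum_eq_zero (hT _ (hwU y hyY)) (hwY y hyY).2.1
      (hTC _ (hwU y hyY) i) (d := q - line i (q i)) ?_ fun j => ?_
    · simp [line]
    · have := fderiv_apply_momentum hU hC hY hw hwU hCw hyY ((q, a) - (line i (q i), a)) j
      rw [Prod.mk_sub_mk, sub_self] at this ⊢
      exact this
  let W : Fin n → ℝ × (Fin n → ℝ) → ℝ := fun i x => ∫ σ in q₀ i..x.1, f i (σ, x.2)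
  have hWs : ∀ i, ContDiffOn ℝ ∞ (W i) (Metric.ball (q₀ i) r ×ˢ Metric.ball a₀ r) := fun i =>
    contDiffOn_primitive Metric.isOpen_ball (hf i)
  have hcoord : ∀ q ∈ Metric.ball q₀ r, ∀ i, q i ∈ Metric.ball (q₀ i) r := fun q hq i =>
    (dist_le_pi_dist q q₀ i).trans_lt hq
  have hsub : Metric.ball q₀ r ⊆ Metric.ball q₀ (2 * r) := Metric.ball_subset_ball (by linarith)
  have hgrad : ∀ q ∈ Metric.ball q₀ r, ∀ a ∈ Metric.ball a₀ r,
      gradQ (fun y => ∑ i, W i (y.1 i, y.2)) q a = w (q, a) := by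
    intro q hq a ha
    rw [gradQ_sum_eq (f := f)]
    · exact (funext (hwf q (hsub hq) a ha)).symm
    · intro i
      refine hasDerivAt_primitive (f := fun σ => f i (σ, a)) (r := 2 * r) ?_ ?_
      · exact (hf i).continuousOn.comp (by fun_prop) fun σ hσ => ⟨hσ, ha⟩
      · exact (dist_le_pi_dist q q₀ i).trans_lt (hsub hq)
  have hmemY : ∀ q ∈ Metric.ball q₀ r, ∀ a ∈ Metric.ball a₀ r, (q, a) ∈ Y := fun q hq a ha =>
    hball (hball' q (hsub hq) a ha)
  have hq₀ : q₀ ∈ Metric.ball q₀ r := Metric.mem_ball_self hr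
  have ha₀ : a₀ ∈ Metric.ball a₀ r := Metric.mem_ball_self hr
  refine ⟨W, Metric.ball q₀ r, Metric.ball a₀ r, Metric.isOpen_ball, hq₀, Metric.isOpen_ball, ha₀,
    fun i => (hWs i).mono (Set.prod_mono ?_ le_rfl), ⟨?_, ?_, ?_, ?_⟩, ?_⟩
  · rintro _ ⟨q, hq, rfl⟩
    exact hcoord q hq i
  · refine ContDiffOn.sum fun i _ => (hWs i).comp (by fun_prop) ?_
    rintro y ⟨hq, ha⟩
    exact ⟨hcoord _ hq i, ha⟩
  · intro q hq a ha
    rw [hgrad q hq a ha]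
    exact hwU _ (hmemY q hq a ha)
  · intro q hq a ha j
    rw [hgrad q hq a ha]
    exact hCw _ (hmemY q hq a ha) j
  · intro q hq a ha
    have hy := hmemY q hq a ha
    set N : Matrix (Fin n) (Fin n) ℝ := Matrix.of fun i j =>
      fderiv ℝ (fun a' => gradQ (fun y => ∑ i, W i (y.1 i, y.2)) q a' i) a (Pi.single j 1) with hN
    have hcol : ∀ j, (fun i => N i j) = fderiv ℝ w (q, a) (0, Pi.single j 1) := by
      intro j
      ext i
      have hev : (fun a' => gradQ (fun y => ∑ i, W i (y.1 i, y.2)) q a' i) =ᶠ[nhds a]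
          fun a' => w (q, a') i := by
        filter_upwards [Metric.isOpen_ball.mem_nhds ha] with a' ha'
        rw [hgrad q hq a' ha']
      have hd : HasFDerivAt (fun a' => w (q, a'))
          ((fderiv ℝ w (q, a)).comp (ContinuousLinearMap.inr ℝ (Fin n → ℝ) (Fin n → ℝ))) a :=
        (hwd _ hy).hasFDerivAt.comp a (hasFDerivAt_prodMk_right q a)
      rw [hN, Matrix.of_apply, hev.fderiv_eq, ((hasFDerivAt_pi'.1 hd) i).fderiv]
      rfl
    -- Differentiating `C(q, w(q, a)) = a` in `a` shows that `∂w/∂a` inverts `∂C/∂p`.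
    have hinv : momentumJacobian C (q, w (q, a)) * N = 1 := by
      ext k j
      have h1 := fderiv_apply_momentum hU hC hY hw hwU hCw hy (0, Pi.single j 1) k
      rw [← hcol j, ← momentumJacobian_mulVec] at h1
      rw [Matrix.one_apply, ← Pi.single_apply]
      exact h1
    intro h0
    have := congrArg Matrix.det hinv
    rw [Matrix.det_mul, h0, mul_zero, Matrix.det_one] at this
    exact zero_ne_one this
  · change gradQ (fun y => ∑ i, W i (y.1 i, y.2)) q₀ a₀ = z₀.2
    rw [hgrad q₀ hq₀ a₀ ha₀, hw₀]

end Separation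

end

/-! ### Separability from the Nijenhuis relations -/

theorem mainTheorem1 {n : ℕ} {M : Type*} [TopologicalSpace M] [T2Space M] [SecondCountableTopology M]
    [ChartedSpace (Model n) M] [IsManifold 𝓘(ℝ, Model n) ∞ M]
    (B : SympBiham n M) (φ : OpenPartialHomeomorph M (Phase n)) (hφ : IsDarbouxNijenhuis B φ)
    (C : Fin n → M → ℝ)
    (hC : ∀ i, ContMDiffOn 𝓘(ℝ, Model n) 𝓘(ℝ, ℝ) ∞ (C i) φ.source)
    (F T : M → Matrix (Fin n) (Fin n) ℝ)
    (hF : ∀ i j, ContMDiffOn 𝓘(ℝ, Model n) 𝓘(ℝ, ℝ) ∞ (fun x => F x i j) φ.source)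
    (hT : ∀ i j, ContMDiffOn 𝓘(ℝ, Model n) 𝓘(ℝ, ℝ) ∞ (fun x => T x i j) φ.source)
    (hNX : ∀ x ∈ φ.source, ∀ i,
      B.N x (B.hamVF (C i) x) = ∑ j, F x i j • B.hamVF (C j) x)
    (hNF : ∀ x ∈ φ.source, ∀ i j,
      B.Nstar x (diffl n (fun y => F y i j) x) = ∑ k, F x i k • diffl n (fun y => F y k j) x)
    (hTdet : ∀ x ∈ φ.source, (T x).det ≠ 0)
    (hFT : ∀ x ∈ φ.source,
      F x = (T x)⁻¹ * Matrix.diagonal (fun i => lam φ i x) * T x)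
    (k : Fin n → Fin n) (c : Fin n → ℝ) (hc : ∀ i, c i ≠ 0)
    (hnorm : ∀ x ∈ φ.source, ∀ i, T x i (k i) = c i) :
    (∀ i, DependsOnlyOnPair φ i (fun x => (T x).mulVec (fun j => C j x) i)) ∧
    (∀ i j, DependsOnlyOnPair φ i (fun x => T x i j)) ∧
    (∀ x ∈ φ.source, (momentumJacobian (fun j => C j ∘ φ.symm) (φ x)).det ≠ 0 →
      HJSeparatesAt (fun j => C j ∘ φ.symm) φ.target (φ x)) := by
  have hd : ∀ {f : M → ℝ}, ContMDiffOn 𝓘(ℝ, Model n) 𝓘(ℝ, ℝ) ∞ f φ.source → ∀ x ∈ φ.source,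
      MDifferentiableAt 𝓘(ℝ, Model n) 𝓘(ℝ, ℝ) f x := fun hf x hx =>
    (hf.contMDiffAt (φ.open_source.mem_nhds hx)).mdifferentiableAt (by simp)
  have hU := φ.open_target
  have hC' : ∀ i, ContDiffOn ℝ ∞ (C i ∘ φ.symm) φ.target := fun i =>
    hφ.contDiffOn_comp_symm (hC i)
  have hF' : ∀ i j, ContDiffOn ℝ ∞ (fun z => F (φ.symm z) i j) φ.target := fun i j =>
    hφ.contDiffOn_comp_symm (hF i j)
  have hT' : ∀ i j, ContDiffOn ℝ ∞ (fun z => T (φ.symm z) i j) φ.target := fun i j =>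
    hφ.contDiffOn_comp_symm (hT i j)
  have hTdet' : ∀ z ∈ φ.target, (T (φ.symm z)).det ≠ 0 := fun z hz => hTdet _ (φ.map_target hz)
  have hTF : ∀ z ∈ φ.target,
      T (φ.symm z) * F (φ.symm z) = Matrix.diagonal z.1 * T (φ.symm z) := by
    intro z hz
    have hlam : (fun i => lam φ i (φ.symm z)) = z.1 := by
      ext i
      rw [lam, φ.right_inv hz]
    rw [hFT _ (φ.map_target hz), hlam, Matrix.mul_assoc,
      Matrix.mul_nonsing_inv_cancel_left _ _ (isUnit_iff_ne_zero.2 (hTdet' z hz))]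
  -- On the plane of the `m`-th pair the operator `N` is multiplication by `λₘ`.
  have hN : ∀ {f : M → ℝ}, ContMDiffOn 𝓘(ℝ, Model n) 𝓘(ℝ, ℝ) ∞ f φ.source → ∀ z ∈ φ.target,
      ∀ m w, diffl n f (φ.symm z) (B.N (φ.symm z) (coordVec φ (φ.symm z) (pairIncl m w))) =
        z.1 m * fderiv ℝ (f ∘ φ.symm) z (pairIncl m w) := by
    intro f hf z hz m w
    have hx := φ.map_target hz
    rw [hφ.N_coordVec_pairIncl hx, map_smul, hφ.diffl_coordVec hx (hd hf _ hx), φ.right_inv hz,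
      smul_eq_mul]
  have hdz : ∀ {f : M → ℝ}, ContMDiffOn 𝓘(ℝ, Model n) 𝓘(ℝ, ℝ) ∞ f φ.source → ∀ z ∈ φ.target,
      ∀ v, diffl n f (φ.symm z) (coordVec φ (φ.symm z) v) = fderiv ℝ (f ∘ φ.symm) z v := by
    intro f hf z hz v
    have hx := φ.map_target hz
    rw [hφ.diffl_coordVec hx (hd hf _ hx), φ.right_inv hz]
  have hNF' : ∀ z ∈ φ.target, ∀ i j m w,
      z.1 m * fderiv ℝ (fun y => F (φ.symm y) i j) z (pairIncl m w) =
        ∑ p, F (φ.symm z) i p * fderiv ℝ (fun y => F (φ.symm y) p j) z (pairIncl m w) := by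
    intro z hz i j m w
    have h := LinearMap.congr_fun (hNF _ (φ.map_target hz) i j)
      (coordVec φ (φ.symm z) (pairIncl m w))
    refine (hN (hF i j) z hz m w).symm.trans (h.trans ?_)
    rw [LinearMap.sum_apply]
    refine Finset.sum_congr rfl fun p _ => ?_
    rw [LinearMap.smul_apply, hdz (hF p j) z hz]
    rfl
  have hNC' : ∀ z ∈ φ.target, ∀ i m w,
      z.1 m * fderiv ℝ (C i ∘ φ.symm) z (pairIncl m w) =
        ∑ p, F (φ.symm z) i p * fderiv ℝ (C p ∘ φ.symm) z (pairIncl m w) := by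
    intro z hz i m w
    rw [← hN (hC i) z hz m w, B.diffl_N_eq (hNX _ (φ.map_target hz) i)]
    exact Finset.sum_congr rfl fun p _ => by rw [hdz (hC p) z hz]
  have hrow : ∀ z ∈ φ.target, ∀ l m, m ≠ l → ∀ j w,
      fderiv ℝ (fun y => T (φ.symm y) l j) z (pairIncl m w) = 0 := fun z hz l m hml j w =>
    fderiv_row_eq_zero (F := fun z => F (φ.symm z)) (T := fun z => T (φ.symm z)) hU hF' hT' hTdet'
      hTF hNF' hc (fun z hz => hnorm _ (φ.map_target hz)) hml j w hz
  have hTC : ∀ z ∈ φ.target, ∀ l m, m ≠ l → ∀ w,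
      ∑ j, T (φ.symm z) l j * fderiv ℝ (C j ∘ φ.symm) z (pairIncl m w) = 0 :=
    fun z hz l m hml w => sum_row_mul_fderiv_eq_zero (F := fun z => F (φ.symm z))
      (T := fun z => T (φ.symm z)) hU hC' hT' hTF hNC' hml w hz
  refine ⟨fun i => ?_, fun i j => ?_, fun x hx hdet => ?_⟩
  · refine dependsOnlyOnPair_of_fderiv_eq_zero ?_ fun z hz m hm w => ?_
    · change ContDiffOn ℝ ∞ (fun z => ∑ j, T (φ.symm z) i j * (C j ∘ φ.symm) z) φ.target
      exact ContDiffOn.sum fun j _ => (hT' i j).mul (hC' j)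
    · exact fderiv_mulVec_eq_zero (T := fun z => T (φ.symm z)) hU hC' hT' hz
        (fun j => hrow z hz i m hm j w) (hTC z hz i m hm w)
  · exact dependsOnlyOnPair_of_fderiv_eq_zero (hT' i j) fun z hz m hm w => hrow z hz i m hm j w
  · exact hjSeparatesAt_of_sum_mul_fderiv_eq_zero hU hC' (T := fun z => T (φ.symm z)) hTdet' hTC
      (φ.map_source hx) hdet
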